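/- Let $N_t\ge 2$ and $M\ge 1$ be integers and $\gamma>0$. Let $\mathbf h_1,\mathbf h_2,\dots$ be i.i.d. random vectors in $\mathbb C^{N_t}$ with i.i.d. $\mathcal{CN}(0,1)$ coefficients; put $\rho_u=\|\mathbf h_u\|^2$ and $\mathbf s_u=\mathbf h_u/\|\mathbf h_u\|$. A codebook is a collection $\mathcal F=\{\mathbf v^{(m)}_n: 1\le m\le M,\,1\le n\le N_t\}$ such that $\mathbf v^{(m)}_1,\dots,\mathbf v^{(m)}_{N_t}$ is an orthonormal basis of $\mathbb C^{N_t}$ for every $m$. With $d(\mathbf v,\mathbf s)=1-|\mathbf v^\dagger\mathbf s|^2$, let $\epsilon_u=\min_{\mathbf v\in\mathcal F}d(\mathbf v,\mathbf s_u)$ be the quantization error, let $d_{\min}$ be the minimum of $\frac14 d(\mathbf v^{(m)}_n,\mathbf v^{(m')}_{n'})$ over all $(m,n)\ne(m',n')$, and for $U$ users let $$\mathcal I^{(m)}_n=\{1\le u\le U: d(\mathbf v^{(m)}_n,\mathbf s_u)<d(\mathbf v^{(m')}_{n'},\mathbf s_u)\text{ for all }(m',n')\ne(m,n)\}.$$ The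 noise-limited SINR of user $u$ is $\gamma\rho_u(1-\epsilon_u)$, and the throughput of PU2RC (per user unitary and rate control) is $$R^{(\beta)}=\mathbb E\Big[\max_{1\le m\le M}\sum_{n=1}^{N_t}\log\Big(1+\max_{u\in\mathcal I^{(m)}_n}\gamma\rho_u(1-\epsilon_u)\Big)\Big],$$ where the maximum over an empty set of users is $0$. Suppose that $\mathcal F$ is either (a) random, consisting of $M$ independent Haar-distributed orthonormal bases that are independent of the channels (the expectation is then over the codebook as well), or (b) any fixed codebook with $d_{\min}>0$. Then, in case (a), $d_{\min}>0$ almost surely, and in both cases the expectation above is finite for every $U$ and $$\lim_{U\to\infty}\frac{R^{(\beta)}}{N_t\log\log U}=1 .$$ Moreover, the scaling is achieved by users whose quantization error is below $d_{\min}$ and whose channel power grows like $\log U$: for every $\delta>0$ the same limit holds, in both cases, if each $\mathcal I^{(m)}_n$ in the definition of $R^{(\beta)}$ is replaced by its subset of users with $\epsilon_u<d_{\min}$ and $(1-\delta)\log U\le\rho_u\le(1+\delta)\log U$. -/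

import Mathlib

open MeasureTheory ProbabilityTheory Filter Topology

noncomputable section

namespace PU2RC

/-- The space `ℂ^n` with its Hermitian inner product (antilinear in the first argument). -/
abbrev Vec (n : ℕ) : Type := EuclideanSpace ℂ (Fin n)

/-- The law on `ℂ^n` of a vector with i.i.d. `CN(0,1)` coefficients: real and imaginary parts of
the coefficients are independent real Gaussians with mean `0` and variance `1/2`. -/
def complexGaussian (n : ℕ) : Measure (Vec n) :=
  (Measure.pi fun _ : Fin n => (gaussianReal 0 (1 / 2)).prod (gaussianReal 0 (1 / 2))).map
    fun z => WithLp.toLp 2 fun k => ((z k).1 : ℂ) + ((z k).2 : ℂ) * Complex.I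

/-- The downlink channels of the users are i.i.d. vectors with i.i.d. `CN(0,1)` coefficients. -/
structure IsRayleighChannel {Ω : Type*} [MeasurableSpace Ω] {n : ℕ} (P : Measure Ω)
    (h : ℕ → Ω → Vec n) : Prop where
  measurable : ∀ u, Measurable (h u)
  law : ∀ u, P.map (h u) = complexGaussian n
  indep : iIndepFun h P

/-- An indexed family `F m k`, `m < M`, `k < n`, of vectors of `ℂ^n`; for a codebook, the
vectors `F m 0, …, F m (n - 1)` are the `m`-th orthonormal basis. -/
abbrev Codebook (M n : ℕ) : Type := Fin M → Fin n → Vec n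

/-- The codebook consists of independent random orthonormal bases, each of which is
isotropic (Haar distributed): applying a fixed unitary map does not change its law. -/
structure IsRandomCodebook {Ω : Type*} [MeasurableSpace Ω] {M n : ℕ} (P : Measure Ω)
    (B : Ω → Codebook M n) : Prop where
  measurable : Measurable B
  orthonormal : ∀ ω m, Orthonormal ℂ (B ω m)
  indep : iIndepFun (fun m ω => B ω m) P
  isotropic : ∀ (m : Fin M) (Q : Vec n ≃ₗᵢ[ℂ] Vec n),
    P.map (fun ω k => Q (B ω m k)) = P.map (fun ω => B ω m)

/-- The channel power `ρ = ‖h‖²`. -/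
def power {n : ℕ} (h : Vec n) : ℝ := ‖h‖ ^ 2

/-- The channel shape `s = h / ‖h‖`. -/
def shape {n : ℕ} (h : Vec n) : Vec n := ((‖h‖⁻¹ : ℝ) : ℂ) • h

/-- The distortion `d(v, s) = 1 - |v† s|²`. -/
def distortion {n : ℕ} (v s : Vec n) : ℝ := 1 - ‖inner ℂ v s‖ ^ 2

/-- The quantization error `ε` of the channel `h`: the smallest distortion between its shape and
the members of the codebook. -/
def quantError {M n : ℕ} (F : Codebook M n) (h : Vec n) : ℝ :=
  ⨅ i : Fin M × Fin n, distortion (F i.1 i.2) (shape h)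

/-- The constant `d_min`: a quarter of the smallest distortion between two different members of
the codebook. -/
def dmin {M n : ℕ} (F : Codebook M n) : ℝ :=
  ⨅ p : {p : (Fin M × Fin n) × (Fin M × Fin n) // p.1 ≠ p.2},
    distortion (F p.1.1.1 p.1.1.2) (F p.1.2.1 p.1.2.2) / 4

open scoped Classical in
/-- The users among `0, …, U - 1` whose channel shape is quantized to `F m k`: this member of the
codebook has a smaller distortion than every other one. -/
def userSet {M n : ℕ} (F : Codebook M n) (h : ℕ → Vec n) (U : ℕ) (m : Fin M) (k : Fin n) :
    Finset ℕ :=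
  (Finset.range U).filter fun u => ∀ i : Fin M × Fin n, i ≠ (m, k) →
    distortion (F m k) (shape (h u)) < distortion (F i.1 i.2) (shape (h u))

open scoped Classical in
/-- The users of `userSet` with quantization error below `d_min` and channel power
between `(1 - δ) log U` and `(1 + δ) log U`. -/
def goodUserSet {M n : ℕ} (δ : ℝ) (F : Codebook M n) (h : ℕ → Vec n) (U : ℕ) (m : Fin M)
    (k : Fin n) : Finset ℕ :=
  (userSet F h U m k).filter fun u => quantError F (h u) < dmin F ∧
    (1 - δ) * Real.log U ≤ power (h u) ∧ power (h u) ≤ (1 + δ) * Real.log U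

/-- The SINR in the noise-limited regime, `γ ρ (1 - ε)`. -/
def sinr {M n : ℕ} (γ : ℝ) (F : Codebook M n) (h : Vec n) : ℝ :=
  γ * power h * (1 - quantError F h)

open scoped Classical in
/-- The maximum of `f` over `S`, set to `0` if `S` is empty. -/
def maxOrZero (S : Finset ℕ) (f : ℕ → ℝ) : ℝ :=
  if hS : S.Nonempty then S.sup' hS f else 0

/-- The sum rate of the best basis of the codebook, when the basis vector number `k` of the basis
number `m` is assigned the user of the set `S m k` with the largest SINR. -/
def sumRate {M n : ℕ} (γ : ℝ) (F : Codebook M n) (h : ℕ → Vec n)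
    (S : Fin M → Fin n → Finset ℕ) : ℝ :=
  ⨆ m : Fin M, ∑ k : Fin n, Real.log (1 + maxOrZero (S m k) fun u => sinr γ F (h u))

/-- The throughput of PU2RC with `U` users in the noise-limited regime, for a (possibly constant)
random codebook `B` and random channels `h`. -/
def throughput {Ω : Type*} [MeasurableSpace Ω] {M n : ℕ} (P : Measure Ω) (γ : ℝ)
    (B : Ω → Codebook M n) (h : ℕ → Ω → Vec n) (U : ℕ) : ℝ :=
  ∫ ω, sumRate γ (B ω) (fun u => h u ω) (userSet (B ω) (fun u => h u ω) U) ∂P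

/-- The throughput when only users with quantization error below `d_min` and channel power
between `(1 - δ) log U` and `(1 + δ) log U` may be scheduled. -/
def goodThroughput {Ω : Type*} [MeasurableSpace Ω] {M n : ℕ} (P : Measure Ω) (γ δ : ℝ)
    (B : Ω → Codebook M n) (h : ℕ → Ω → Vec n) (U : ℕ) : ℝ :=
  ∫ ω, sumRate γ (B ω) (fun u => h u ω) (goodUserSet δ (B ω) (fun u => h u ω) U) ∂P

end PU2RC

end

noncomputable section

namespace PU2RC

/-! Both cases are instances of `throughput_scaling`, which squeezes the throughput between two
expressions asymptotic to `n log log U`.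

Upper bound (`sumRate_le`, `integral_sumRate_le`): every SINR is at most `γ ρ`, and the largest
power among `U` users is at most `2 log Y` with `Y = ∑ exp (ρ_u / 2)`. Since `E Y = C U` with `C`
finite, concavity of the logarithm, applied twice, bounds the mean rate by `n log (O(1) + 2 γ log
U)`. No extreme-value law is needed.

Lower bound (`tendsto_mul_measure_reliable`, `le_goodThroughput`): for a codebook vector `v`, take
the ball of fixed radius about `r v` with `r ^ 2 = (1 - δ / 2) log U`. Its Gaussian mass is at least
`c exp (-r ^ 2 - K r)`, and `U` times this tends to infinity, so some user falls in it with
probability tending to 1. Seen from the origin the ball subtends an angle `O(1 / r)`, so its points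
are quantized to `v` with small error, and their power is in the prescribed window. Applying this to
all vectors of one basis gives the rate.

A random codebook is conditioned upon by independence, which requires `d_min > 0` almost surely
(`IsRandomCodebook.ae_dmin_pos`): an isotropic unit vector almost surely avoids any given complex
line. -/

theorem tendsto_log_affine_div_log (a b : ℝ) (ha : 0 < a) :
    Tendsto (fun x : ℝ => Real.log (b + a * x) / Real.log x) atTop (𝓝 1) := by
  -- Uses `log (b + a x) = log x + log (a + b / x)`, whose last term stays bounded.
  have h1 : Tendsto (fun x : ℝ => 1 + Real.log (b * x⁻¹ + a) * (Real.log x)⁻¹) atTop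
      (𝓝 (1 + Real.log (b * 0 + a) * 0)) := by
    refine tendsto_const_nhds.add (Tendsto.mul ?_ ?_)
    · refine ((Real.continuousAt_log (by simpa using ha.ne')).tendsto).comp ?_
      exact (tendsto_inv_atTop_zero.const_mul b).add_const a
    · exact tendsto_inv_atTop_zero.comp Real.tendsto_log_atTop
  rw [mul_zero, add_zero] at h1
  refine h1.congr' ?_
  have h2 : ∀ᶠ x : ℝ in atTop, 0 < b * x⁻¹ + a := by
    have : Tendsto (fun x : ℝ => b * x⁻¹ + a) atTop (𝓝 (b * 0 + a)) :=
      (tendsto_inv_atTop_zero.const_mul b).add_const a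
    exact this.eventually (lt_mem_nhds (by simpa using ha))
  filter_upwards [h2, eventually_gt_atTop 1] with x hx hx1
  have hx0 : 0 < x := by linarith
  have hl : 0 < Real.log x := Real.log_pos hx1
  have : b + a * x = (b * x⁻¹ + a) * x := by field_simp
  rw [this, Real.log_mul hx.ne' hx0.ne']
  field_simp
  ring

/-- With `x = log U`, this is the growth of `U` times the mass of the ball: the gain `a x` comes
from aiming below power `log U`, the loss `K √x` from the fixed radius of the ball. -/
theorem tendsto_exp_linear_sub_sqrt (a K : ℝ) (ha : 0 < a) :
    Tendsto (fun x : ℝ => Real.exp (a * x - K * √x)) atTop atTop := by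
  refine Real.tendsto_exp_atTop.comp ?_
  have h1 : Tendsto (fun x : ℝ => √x * (a * √x - K)) atTop atTop :=
    Real.tendsto_sqrt_atTop.atTop_mul_atTop₀
      (tendsto_atTop_add_const_right _ (-K) (Real.tendsto_sqrt_atTop.const_mul_atTop ha))
  refine h1.congr' ?_
  filter_upwards [eventually_ge_atTop 0] with x hx
  nlinarith [Real.mul_self_sqrt hx]

/-! ### Gaussian estimates: mass of balls and exponential moments -/

/-- The standard real coordinates of a complex vector. -/
def ofCoords (n : ℕ) (z : Fin n → ℝ × ℝ) : Vec n :=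
  WithLp.toLp 2 fun k => ((z k).1 : ℂ) + ((z k).2 : ℂ) * Complex.I

theorem measurable_ofCoords (n : ℕ) : Measurable (ofCoords n) := by
  unfold ofCoords
  refine (WithLp.measurable_toLp 2 _).comp ?_
  fun_prop

theorem norm_sq_ofCoords (n : ℕ) (z : Fin n → ℝ × ℝ) :
    ‖ofCoords n z‖ ^ 2 = ∑ k, ((z k).1 ^ 2 + (z k).2 ^ 2) := by
  rw [EuclideanSpace.norm_sq_eq]
  refine Finset.sum_congr rfl fun k _ => ?_
  rw [← Complex.normSq_eq_norm_sq]
  simp [ofCoords, Complex.normSq_add_mul_I]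

instance (n : ℕ) : IsProbabilityMeasure (complexGaussian n) :=
  Measure.isProbabilityMeasure_map (measurable_ofCoords n).aemeasurable

/-- The density is `π^(-1/2) exp (-x ^ 2)`, and `x ^ 2 ≤ (|a| + 1) ^ 2` on the interval. Allowing
any `r ≥ |a|` lets all coordinates of a vector share its norm as `r`. -/
theorem gaussianReal_Icc_ge (a r : ℝ) (har : |a| ≤ r) :
    ENNReal.ofReal (2 * (√Real.pi)⁻¹ * Real.exp (-(a ^ 2 + 2 * r + 1))) ≤
      gaussianReal 0 (1 / 2) (Set.Icc (a - 1) (a + 1)) := by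
  rw [gaussianReal_apply _ (by norm_num)]
  calc _ = ∫⁻ _ in Set.Icc (a - 1) (a + 1),
        ENNReal.ofReal ((√Real.pi)⁻¹ * Real.exp (-(a ^ 2 + 2 * r + 1))) := by
        rw [setLIntegral_const, Real.volume_Icc, ← ENNReal.ofReal_mul (by positivity)]
        congr 1; ring
    _ ≤ _ := by
        refine setLIntegral_mono (measurable_gaussianPDF _ _) fun x hx => ?_
        refine ENNReal.ofReal_le_ofReal ?_
        rw [gaussianPDFReal]
        have h1 : (2 * Real.pi * ((1 / 2 : NNReal) : ℝ)) = Real.pi := by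
          push_cast; ring
        rw [h1]
        gcongr
        push_cast
        have h2 : |x| ≤ |a| + 1 := by
          have h3 : |x - a| ≤ 1 := abs_le.2 ⟨by linarith [hx.1], by linarith [hx.2]⟩
          have := abs_add_le (x - a) a
          simp only [sub_add_cancel] at this
          linarith
        have h4 : x ^ 2 ≤ (|a| + 1) ^ 2 := by
          rw [← sq_abs x]; gcongr
        have h5 := sq_abs a
        have h6 : -(x - 0) ^ 2 / (2 * (1 / 2)) = - x ^ 2 := by ring
        rw [h6]
        nlinarith

theorem norm_ofCoords_sub_le (n : ℕ) (z : Fin n → ℝ × ℝ) (a : Vec n)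
    (h : ∀ k, |(z k).1 - (a k).re| ≤ 1 ∧ |(z k).2 - (a k).im| ≤ 1) :
    ‖ofCoords n z - a‖ ≤ √(2 * n) := by
  refine Real.le_sqrt_of_sq_le ?_
  rw [EuclideanSpace.norm_sq_eq]
  calc _ ≤ ∑ _k : Fin n, (2 : ℝ) := by
        refine Finset.sum_le_sum fun k _ => ?_
        rw [← Complex.normSq_eq_norm_sq, Complex.normSq_apply]
        simp only [ofCoords, PiLp.sub_apply, Complex.sub_re, Complex.sub_im, Complex.add_re,
          Complex.add_im, Complex.ofReal_re, Complex.ofReal_im, Complex.mul_re, Complex.mul_im,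
          Complex.I_re, Complex.I_im]
        have h1 := abs_le.1 (h k).1
        have h2 := abs_le.1 (h k).2
        nlinarith
    _ = _ := by simp [mul_comm]

/-- The Gaussian measure of a ball of a fixed radius decays at most like `exp (-‖a‖² - K ‖a‖)`
in its centre `a`. -/
theorem exists_complexGaussian_closedBall_ge (n : ℕ) :
    ∃ c > 0, ∃ K ≥ 0, ∀ a : Vec n,
      c * Real.exp (-(‖a‖ ^ 2 + K * ‖a‖)) ≤
        (complexGaussian n).real (Metric.closedBall a (√(2 * n))) := by
  set q : ℝ := 2 * (√Real.pi)⁻¹ with hq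
  have hq0 : 0 < q := by positivity
  refine ⟨∏ _k : Fin n, (q * q * Real.exp (-2)), by positivity, 4 * n, by positivity, fun a => ?_⟩
  have hre : ∀ k, |(a k).re| ≤ ‖a‖ := fun k => (Complex.abs_re_le_norm _).trans (PiLp.norm_apply_le a k)
  have him : ∀ k, |(a k).im| ≤ ‖a‖ := fun k => (Complex.abs_im_le_norm _).trans (PiLp.norm_apply_le a k)
  -- A box inside the ball, on which the product measure factorizes into one-dimensional bounds.
  set box : Set (Fin n → ℝ × ℝ) := Set.pi Set.univ fun k =>
    Set.Icc ((a k).re - 1) ((a k).re + 1) ×ˢ Set.Icc ((a k).im - 1) ((a k).im + 1) with hbox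
  have hsub : box ⊆ ofCoords n ⁻¹' Metric.closedBall a (√(2 * n)) := by
    intro z hz
    rw [Set.mem_preimage, mem_closedBall_iff_norm]
    refine norm_ofCoords_sub_le n z a fun k => ?_
    obtain ⟨⟨h1, h2⟩, h3, h4⟩ := hz k (Set.mem_univ k)
    exact ⟨abs_le.2 ⟨by linarith, by linarith⟩, abs_le.2 ⟨by linarith, by linarith⟩⟩
  rw [measureReal_def]
  refine (ENNReal.ofReal_le_iff_le_toReal (measure_ne_top _ _)).1 ?_
  have hmap : complexGaussian n (Metric.closedBall a (√(2 * n))) =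
      (Measure.pi fun _ : Fin n => (gaussianReal 0 (1 / 2)).prod (gaussianReal 0 (1 / 2)))
        (ofCoords n ⁻¹' Metric.closedBall a (√(2 * n))) :=
    Measure.map_apply (measurable_ofCoords n) Metric.isClosed_closedBall.measurableSet
  rw [hmap]
  refine le_trans ?_ (measure_mono hsub)
  rw [hbox, Measure.pi_pi]
  simp_rw [Measure.prod_prod]
  calc _ = ∏ k : Fin n, (ENNReal.ofReal (q * Real.exp (-((a k).re ^ 2 + 2 * ‖a‖ + 1))) *
          ENNReal.ofReal (q * Real.exp (-((a k).im ^ 2 + 2 * ‖a‖ + 1)))) := by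
        simp_rw [← ENNReal.ofReal_mul (mul_nonneg hq0.le (Real.exp_nonneg _))]
        rw [← ENNReal.ofReal_prod_of_nonneg fun _ _ => by positivity]
        congr 1
        have h1 : ‖a‖ ^ 2 = ∑ k, ((a k).re ^ 2 + (a k).im ^ 2) := by
          rw [EuclideanSpace.norm_sq_eq]
          refine Finset.sum_congr rfl fun k _ => ?_
          rw [← Complex.normSq_eq_norm_sq, Complex.normSq_apply]; ring
        have h2 : -(‖a‖ ^ 2 + 4 * n * ‖a‖) =
            ∑ k : Fin n, -((a k).re ^ 2 + (a k).im ^ 2 + 4 * ‖a‖) := by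
          rw [Finset.sum_neg_distrib, Finset.sum_add_distrib, ← h1]
          simp; ring
        rw [h2, Real.exp_sum, ← Finset.prod_mul_distrib]
        refine Finset.prod_congr rfl fun k _ => ?_
        rw [mul_assoc, ← Real.exp_add, mul_mul_mul_comm q _ q, ← Real.exp_add]
        congr 2; ring
    _ ≤ _ := Finset.prod_le_prod' fun k _ =>
        mul_le_mul' (gaussianReal_Icc_ge _ _ (hre k)) (gaussianReal_Icc_ge _ _ (him k))

/-- Against the density `π^(-1/2) exp (-x ^ 2)`, the integrand becomes a multiple of `exp (-x ^ 2 /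
2)`. -/
theorem integrable_exp_half_sq :
    Integrable (fun x : ℝ => Real.exp (x ^ 2 / 2)) (gaussianReal 0 (1 / 2)) := by
  rw [gaussianReal_of_var_ne_zero _ (by norm_num),
    integrable_withDensity_iff (measurable_gaussianPDF _ _)
      (ae_of_all _ fun _ => gaussianPDF_lt_top)]
  refine ((integrable_exp_neg_mul_sq (b := 1 / 2) (by norm_num)).const_mul
    (√Real.pi)⁻¹).congr (ae_of_all _ fun x => ?_)
  simp only [toReal_gaussianPDF, gaussianPDFReal]
  have h1 : (2 * Real.pi * ((1 / 2 : NNReal) : ℝ)) = Real.pi := by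
    push_cast; ring
  rw [h1, mul_left_comm, ← Real.exp_add]
  congr 2
  push_cast
  ring

theorem integrable_exp_half_power (n : ℕ) :
    Integrable (fun x : Vec n => Real.exp (power x / 2)) (complexGaussian n) := by
  have hm : Measurable fun x : Vec n => Real.exp (power x / 2) := by unfold power; fun_prop
  refine (integrable_map_measure hm.aestronglyMeasurable
    (measurable_ofCoords n).aemeasurable).2 ?_
  have h1 : Integrable (fun z : Fin n → ℝ × ℝ =>
      ∏ k, (Real.exp ((z k).1 ^ 2 / 2) * Real.exp ((z k).2 ^ 2 / 2)))
      (Measure.pi fun _ : Fin n => (gaussianReal 0 (1 / 2)).prod (gaussianReal 0 (1 / 2))) :=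
    Integrable.fintype_prod (f := fun _ (p : ℝ × ℝ) => Real.exp (p.1 ^ 2 / 2) * Real.exp (p.2 ^ 2 / 2))
      fun _ => integrable_exp_half_sq.mul_prod integrable_exp_half_sq
  refine h1.congr (ae_of_all _ fun z => ?_)
  simp only [Function.comp, power, norm_sq_ofCoords]
  rw [Finset.sum_div, Real.exp_sum]
  refine Finset.prod_congr rfl fun k _ => ?_
  rw [← Real.exp_add]; congr 1; ring

/-! ### Measurability -/

variable {M n : ℕ}

theorem measurable_power : Measurable (power : Vec n → ℝ) := by
  unfold power; fun_prop

theorem measurable_shape : Measurable (shape : Vec n → Vec n) := by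
  unfold shape; fun_prop

theorem measurable_distortion_shape (m : Fin M) (k : Fin n) :
    Measurable fun p : Codebook M n × Vec n => distortion (p.1 m k) (shape p.2) := by
  unfold distortion
  have h1 : Measurable fun p : Codebook M n × Vec n => p.1 m k := by fun_prop
  exact measurable_const.sub ((h1.inner (measurable_shape.comp measurable_snd)).norm.pow_const 2)

theorem measurable_quantError :
    Measurable fun p : Codebook M n × Vec n => quantError p.1 p.2 :=
  Measurable.iInf fun i => measurable_distortion_shape i.1 i.2

theorem measurable_dmin : Measurable (dmin : Codebook M n → ℝ) := by
  refine Measurable.iInf fun p => ?_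
  unfold distortion
  have h1 : Measurable fun F : Codebook M n => F p.1.1.1 p.1.1.2 := by fun_prop
  have h2 : Measurable fun F : Codebook M n => F p.1.2.1 p.1.2.2 := by fun_prop
  exact (measurable_const.sub ((h1.inner h2).norm.pow_const 2)).div_const 4

theorem measurable_sinr (γ : ℝ) :
    Measurable fun p : Codebook M n × Vec n => sinr γ p.1 p.2 := by
  unfold sinr
  exact ((measurable_power.comp measurable_snd).const_mul γ).mul
    (measurable_const.sub measurable_quantError)

/-- The channels which are strictly closest to the codebook vector `F m k`. -/
def cell (m : Fin M) (k : Fin n) : Set (Codebook M n × Vec n) :=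
  {p | ∀ i : Fin M × Fin n, i ≠ (m, k) →
    distortion (p.1 m k) (shape p.2) < distortion (p.1 i.1 i.2) (shape p.2)}

/-- The channels with quantization error below `d_min` and power between
`(1 - δ) L` and `(1 + δ) L`. -/
def goodRange (δ L : ℝ) : Set (Codebook M n × Vec n) :=
  {p | quantError p.1 p.2 < dmin p.1 ∧ (1 - δ) * L ≤ power p.2 ∧ power p.2 ≤ (1 + δ) * L}

theorem measurableSet_cell (m : Fin M) (k : Fin n) : MeasurableSet (cell m k) := by
  simp only [cell, Set.ofPred_forall]
  exact MeasurableSet.iInter fun i => MeasurableSet.iInter fun _ =>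
    measurableSet_lt (measurable_distortion_shape m k) (measurable_distortion_shape i.1 i.2)

theorem measurableSet_goodRange (δ L : ℝ) :
    MeasurableSet (goodRange δ L : Set (Codebook M n × Vec n)) := by
  refine (measurableSet_lt measurable_quantError (measurable_dmin.comp measurable_fst)).inter
    ((measurableSet_le measurable_const (measurable_power.comp measurable_snd)).inter
    (measurableSet_le (measurable_power.comp measurable_snd) measurable_const))

theorem mem_userSet {F : Codebook M n} {h : ℕ → Vec n} {U : ℕ} {m : Fin M} {k : Fin n} {u : ℕ} :
    u ∈ userSet F h U m k ↔ u < U ∧ (F, h u) ∈ cell m k := by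
  simp [userSet, cell]

theorem mem_goodUserSet {δ : ℝ} {F : Codebook M n} {h : ℕ → Vec n} {U : ℕ} {m : Fin M} {k : Fin n}
    {u : ℕ} : u ∈ goodUserSet δ F h U m k ↔
      (u < U ∧ (F, h u) ∈ cell m k) ∧ (F, h u) ∈ goodRange δ (Real.log U) := by
  simp [goodUserSet, goodRange, mem_userSet]

/-- There are only countably many finite sets of users, so it suffices to treat the maximum over
each fixed set. -/
theorem measurable_maxOrZero {Ω : Type*} [MeasurableSpace Ω] {S : Ω → Finset ℕ} {f : Ω → ℕ → ℝ}
    (hS : ∀ u, MeasurableSet {ω | u ∈ S ω}) (hf : ∀ u, Measurable fun ω => f ω u) :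
    Measurable fun ω => maxOrZero (S ω) (f ω) := by
  let _ : MeasurableSpace (Finset ℕ) := ⊤
  have hSm : Measurable S := by
    refine measurable_to_countable' fun T => ?_
    have : S ⁻¹' {T} = ⋂ u, {ω | u ∈ S ω ↔ u ∈ T} := by
      ext ω; simp [Finset.ext_iff]
    rw [this]
    refine MeasurableSet.iInter fun u => ?_
    by_cases hu : u ∈ T
    · simpa [hu] using hS u
    · simp only [hu, iff_false]
      exact (hS u).compl
  have h2 : Measurable fun p : Finset ℕ × Ω => maxOrZero p.1 (f p.2) := by
    refine measurable_from_prod_countable_right fun T => ?_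
    by_cases hT : T.Nonempty
    · simp only [maxOrZero, hT, dif_pos]
      have h3 := Finset.measurable_sup' hT (f := fun u ω => f ω u) fun _ _ => hf _
      convert h3 using 2 with ω
      simp
    · simp only [maxOrZero, hT, dif_neg, not_false_eq_true, measurable_const]
  exact h2.comp (hSm.prodMk measurable_id)

theorem measurable_sumRate {Ω : Type*} [MeasurableSpace Ω] (γ : ℝ) {B : Ω → Codebook M n}
    {h : ℕ → Ω → Vec n} (hB : Measurable B) (hh : ∀ u, Measurable (h u))
    {S : Ω → Fin M → Fin n → Finset ℕ} (hS : ∀ m k u, MeasurableSet {ω | u ∈ S ω m k}) :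
    Measurable fun ω => sumRate γ (B ω) (fun u => h u ω) (S ω) := by
  unfold sumRate
  have h1 : ∀ u, Measurable fun ω => sinr γ (B ω) (h u ω) := fun u => by
    have h3 : Measurable fun ω => (B ω, h u ω) := hB.prodMk (hh u)
    have h4 := (measurable_sinr γ).comp h3
    simpa only [Function.comp_def] using h4
  have h2 : ∀ m k, Measurable fun ω => maxOrZero (S ω m k) fun u => sinr γ (B ω) (h u ω) :=
    fun m k => measurable_maxOrZero (hS m k) h1
  exact Measurable.iSup fun m => Finset.measurable_sum _ fun k _ =>
    Real.measurable_log.comp (measurable_const.add (h2 m k))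

theorem measurableSet_mem_userSet {Ω : Type*} [MeasurableSpace Ω] {B : Ω → Codebook M n}
    {h : ℕ → Ω → Vec n} (hB : Measurable B) (hh : ∀ u, Measurable (h u)) (U : ℕ) (m : Fin M)
    (k : Fin n) (u : ℕ) :
    MeasurableSet {ω | u ∈ userSet (B ω) (fun u => h u ω) U m k} := by
  simp only [mem_userSet]
  exact (MeasurableSet.const _).inter ((hB.prodMk (hh u)) (measurableSet_cell m k))

theorem measurableSet_mem_goodUserSet {Ω : Type*} [MeasurableSpace Ω] (δ : ℝ)
    {B : Ω → Codebook M n} {h : ℕ → Ω → Vec n} (hB : Measurable B) (hh : ∀ u, Measurable (h u))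
    (U : ℕ) (m : Fin M) (k : Fin n) (u : ℕ) :
    MeasurableSet {ω | u ∈ goodUserSet δ (B ω) (fun u => h u ω) U m k} := by
  simp only [mem_goodUserSet]
  exact ((MeasurableSet.const _).inter ((hB.prodMk (hh u)) (measurableSet_cell m k))).inter
    ((hB.prodMk (hh u)) (measurableSet_goodRange δ _))

/-! ### Deterministic bounds on distortion, SINR and sum rate -/

theorem norm_shape_le (x : Vec n) : ‖shape x‖ ≤ 1 := by
  rw [shape, norm_smul, Complex.norm_real, norm_inv, norm_norm]
  exact inv_mul_le_one

theorem distortion_nonneg {v s : Vec n} (hv : ‖v‖ ≤ 1) (hs : ‖s‖ ≤ 1) : 0 ≤ distortion v s := by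
  have h1 : ‖inner ℂ v s‖ ≤ 1 :=
    (norm_inner_le_norm v s).trans (mul_le_one₀ hv (norm_nonneg _) hs)
  have h2 : ‖inner ℂ v s‖ ^ 2 ≤ 1 := pow_le_one₀ (norm_nonneg _) h1
  unfold distortion; linarith

theorem distortion_le_one (v s : Vec n) : distortion v s ≤ 1 := by
  have := sq_nonneg ‖inner ℂ v s‖
  unfold distortion; linarith

theorem quantError_le (F : Codebook M n) (x : Vec n) (m : Fin M) (k : Fin n) :
    quantError F x ≤ distortion (F m k) (shape x) :=
  ciInf_le (Set.finite_range _).bddBelow (m, k)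

theorem quantError_nonneg {F : Codebook M n} (hF : ∀ m, Orthonormal ℂ (F m)) (x : Vec n) :
    0 ≤ quantError F x :=
  Real.iInf_nonneg fun i => distortion_nonneg ((hF i.1).1 i.2).le (norm_shape_le x)

theorem quantError_le_one [Nonempty (Fin M)] [Nonempty (Fin n)] (F : Codebook M n) (x : Vec n) :
    quantError F x ≤ 1 :=
  (quantError_le F x (Classical.arbitrary _) (Classical.arbitrary _)).trans (distortion_le_one _ _)

theorem power_nonneg (x : Vec n) : 0 ≤ power x := sq_nonneg _

theorem sinr_nonneg [Nonempty (Fin M)] [Nonempty (Fin n)] {γ : ℝ} (hγ : 0 ≤ γ)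
    (F : Codebook M n) (x : Vec n) : 0 ≤ sinr γ F x :=
  mul_nonneg (mul_nonneg hγ (power_nonneg x)) (sub_nonneg.2 (quantError_le_one F x))

theorem sinr_le {γ : ℝ} (hγ : 0 ≤ γ) {F : Codebook M n} (hF : ∀ m, Orthonormal ℂ (F m))
    (x : Vec n) : sinr γ F x ≤ γ * power x :=
  mul_le_of_le_one_right (mul_nonneg hγ (power_nonneg x)) (by linarith [quantError_nonneg hF x])

theorem maxOrZero_le {S : Finset ℕ} {f : ℕ → ℝ} {c : ℝ} (hc : 0 ≤ c) (h : ∀ u ∈ S, f u ≤ c) :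
    maxOrZero S f ≤ c := by
  unfold maxOrZero
  split_ifs with hS
  · exact Finset.sup'_le hS f h
  · exact hc

theorem le_maxOrZero {S : Finset ℕ} {u : ℕ} (hu : u ∈ S) (f : ℕ → ℝ) : f u ≤ maxOrZero S f := by
  unfold maxOrZero
  rw [dif_pos ⟨u, hu⟩]
  exact Finset.le_sup' f hu

theorem maxOrZero_nonneg (S : Finset ℕ) {f : ℕ → ℝ} (hf : ∀ u, 0 ≤ f u) : 0 ≤ maxOrZero S f := by
  by_cases hS : S.Nonempty
  · exact (hf _).trans (le_maxOrZero hS.choose_spec f)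
  · simp [maxOrZero, hS]

theorem maxOrZero_mono {S T : Finset ℕ} (hST : S ⊆ T) {f : ℕ → ℝ} (hf : ∀ u, 0 ≤ f u) :
    maxOrZero S f ≤ maxOrZero T f :=
  maxOrZero_le (maxOrZero_nonneg T hf) fun _ hu => le_maxOrZero (hST hu) f

theorem sum_le_sumRate (γ : ℝ) (F : Codebook M n) (h : ℕ → Vec n)
    (S : Fin M → Fin n → Finset ℕ) (m : Fin M) :
    ∑ k : Fin n, Real.log (1 + maxOrZero (S m k) fun u => sinr γ F (h u)) ≤ sumRate γ F h S :=
  le_ciSup (f := fun m => ∑ k : Fin n, Real.log (1 + maxOrZero (S m k) fun u => sinr γ F (h u)))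
    (Set.finite_range _).bddAbove m

section

variable [Nonempty (Fin M)] [Nonempty (Fin n)] {γ : ℝ}

theorem sumRate_nonneg (hγ : 0 ≤ γ) (F : Codebook M n) (h : ℕ → Vec n)
    (S : Fin M → Fin n → Finset ℕ) : 0 ≤ sumRate γ F h S :=
  Real.iSup_nonneg fun m => Finset.sum_nonneg fun k _ => Real.log_nonneg
    (by linarith [maxOrZero_nonneg (S m k) fun u => sinr_nonneg hγ F (h u)])

theorem sumRate_mono (hγ : 0 ≤ γ) (F : Codebook M n) (h : ℕ → Vec n)
    {S T : Fin M → Fin n → Finset ℕ} (hST : ∀ m k, S m k ⊆ T m k) :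
    sumRate γ F h S ≤ sumRate γ F h T := by
  refine ciSup_le fun m => (Finset.sum_le_sum fun k _ => ?_).trans (sum_le_sumRate γ F h T m)
  have h0 := maxOrZero_nonneg (S m k) fun u => sinr_nonneg hγ F (h u)
  exact Real.log_le_log (by linarith)
    (by linarith [maxOrZero_mono (hST m k) fun u => sinr_nonneg hγ F (h u)])

/-- If all scheduled users are among `0, …, U - 1`, then the sum rate is controlled by an exponential
moment of the channel powers, where the logarithms are linearized at arbitrary points `a`, `b`. -/
theorem sumRate_le (hγ : 0 ≤ γ) {F : Codebook M n} (hF : ∀ m, Orthonormal ℂ (F m))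
    (h : ℕ → Vec n) {S : Fin M → Fin n → Finset ℕ} {U : ℕ} (hS : ∀ m k, ∀ u ∈ S m k, u < U)
    {a b : ℝ} (ha : 1 ≤ a) (hb : 0 < b) :
    sumRate γ F h S ≤ n * (Real.log b + (1 + 2 * γ * (Real.log a +
      (∑ u ∈ Finset.range U, Real.exp (power (h u) / 2)) / a)) / b - 1) := by
  set Y := ∑ u ∈ Finset.range U, Real.exp (power (h u) / 2) with hY
  have hY0 : 0 ≤ Y := Finset.sum_nonneg fun _ _ => Real.exp_nonneg _
  have ha0 : 0 < a := by linarith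
  have hz : 0 ≤ Real.log a + Y / a := add_nonneg (Real.log_nonneg ha) (div_nonneg hY0 ha0.le)
  -- The tangent to `log` at `y` lies above it. Keeping the tangent points free gives a bound affine
  -- in `Y`, which can be integrated termwise in place of Jensen's inequality.
  have hlog : ∀ {x y : ℝ}, 0 < x → 0 < y → Real.log x ≤ Real.log y + x / y - 1 := by
    intro x y hx hy
    have := Real.log_le_sub_one_of_pos (div_pos hx hy)
    rw [Real.log_div hx.ne' hy.ne'] at this
    linarith
  have hmax : ∀ m k, maxOrZero (S m k) (fun u => sinr γ F (h u)) ≤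
      2 * γ * (Real.log a + Y / a) := by
    intro m k
    refine maxOrZero_le (by positivity) fun u hu => (sinr_le hγ hF _).trans ?_
    have h1 : Real.exp (power (h u) / 2) ≤ Y :=
      Finset.single_le_sum (f := fun u => Real.exp (power (h u) / 2))
        (fun _ _ => Real.exp_nonneg _) (Finset.mem_range.2 (hS m k u hu))
    have h2 := hlog (Real.exp_pos (power (h u) / 2)) ha0
    rw [Real.log_exp] at h2
    have h3 : Real.exp (power (h u) / 2) / a ≤ Y / a := by gcongr
    have h4 : power (h u) ≤ 2 * (Real.log a + Y / a) := by linarith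
    calc γ * power (h u) ≤ γ * (2 * (Real.log a + Y / a)) := by gcongr
      _ = _ := by ring
  refine ciSup_le fun m => ?_
  calc _ ≤ ∑ _k : Fin n, (Real.log b + (1 + 2 * γ * (Real.log a + Y / a)) / b - 1) := by
        refine Finset.sum_le_sum fun k _ => ?_
        have h0 : 0 ≤ maxOrZero (S m k) fun u => sinr γ F (h u) :=
          maxOrZero_nonneg _ fun u => sinr_nonneg hγ F (h u)
        refine (hlog (by linarith) hb).trans ?_
        have := hmax m k
        gcongr
    _ = _ := by rw [Finset.sum_const, Finset.card_univ, Fintype.card_fin, nsmul_eq_mul]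

end

/-! ### Isotropy and almost sure positivity of the minimum distance -/

theorem exists_linearIsometryEquiv_apply_eq (hn : 0 < n) {v w : Vec n} (hv : ‖v‖ = 1)
    (hw : ‖w‖ = 1) : ∃ Q : Vec n ≃ₗᵢ[ℂ] Vec n, Q v = w := by
  have key : ∀ v : Vec n, ‖v‖ = 1 → ∃ b : OrthonormalBasis (Fin n) ℂ (Vec n), b ⟨0, hn⟩ = v := by
    intro v hv
    have h1 : Orthonormal ℂ (Set.domRestrict {(⟨0, hn⟩ : Fin n)} fun _ => v) :=
      ⟨fun _ => hv, fun i j hij => absurd (Subsingleton.elim i j) hij⟩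
    obtain ⟨b, hb⟩ := h1.exists_orthonormalBasis_extension_of_card_eq (by simp)
    exact ⟨b, hb _ rfl⟩
  obtain ⟨b, hb⟩ := key v hv
  obtain ⟨b', hb'⟩ := key w hw
  refine ⟨b.equiv b' (Equiv.refl _), ?_⟩
  rw [← hb, OrthonormalBasis.equiv_apply_basis, ← hb']
  rfl

/-- A unit vector of `ℂ^n`, `n ≥ 2`, with an isotropic law is almost surely not collinear with a
given unit vector. -/
theorem measure_norm_inner_eq_one (hn : 2 ≤ n) (μ : Measure (Vec n)) [IsFiniteMeasure μ]
    (hunit : ∀ᵐ x ∂μ, ‖x‖ = 1) (hiso : ∀ Q : Vec n ≃ₗᵢ[ℂ] Vec n, μ.map Q = μ)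
    (v : Vec n) (hv : ‖v‖ = 1) : μ {x | ‖inner ℂ v x‖ = 1} = 0 := by
  by_contra hp
  set i0 : Fin n := ⟨0, by omega⟩
  set i1 : Fin n := ⟨1, by omega⟩
  have hi : i1 ≠ i0 := by simp [i0, i1]
  -- Infinitely many disjoint sets, the `j`-th containing the line through `e₀ + j e₁` without its
  -- origin. Isotropy gives every line the mass of the line through `v`, so a positive mass would
  -- contradict finiteness.
  let A : ℕ → Set (Vec n) := fun j => {x | x i0 ≠ 0 ∧ x i1 = j * x i0}
  have hAm : ∀ j, MeasurableSet (A j) := fun j =>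
    (measurableSet_eq_fun (by fun_prop) measurable_const).compl.inter
      (measurableSet_eq_fun (by fun_prop) (by fun_prop))
  have hAd : Pairwise (Function.onFun Disjoint A) := by
    intro i j hij
    refine Set.disjoint_left.2 fun x hx hx' => hij ?_
    have h1 : (i : ℂ) * x i0 = j * x i0 := hx.2.symm.trans hx'.2
    exact Nat.cast_injective (R := ℂ) (mul_right_cancel₀ hx.1 h1)
  have hle : ∀ j, μ {x | ‖inner ℂ v x‖ = 1} ≤ μ (A j) := by
    intro j
    set w' : Vec n := EuclideanSpace.single i0 1 + (j : ℂ) • EuclideanSpace.single i1 1 with hw'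
    have hw0 : w' i0 = 1 := by simp [hw', hi.symm]
    have hw1 : w' i1 = j := by simp [hw', hi]
    have hne : w' ≠ 0 := by
      intro h
      rw [h] at hw0
      simp at hw0
    set w : Vec n := ((‖w'‖⁻¹ : ℝ) : ℂ) • w' with hw
    have hwn : ‖w‖ = 1 := by
      rw [hw, norm_smul, Complex.norm_real, norm_inv, norm_norm,
        inv_mul_cancel₀ (norm_ne_zero_iff.2 hne)]
    obtain ⟨Q, hQ⟩ := exists_linearIsometryEquiv_apply_eq (by omega) hv hwn
    have hm : MeasurableSet {x : Vec n | ‖inner ℂ w x‖ = 1} :=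
      measurableSet_eq_fun (by fun_prop) measurable_const
    have h1 : μ {x | ‖inner ℂ v x‖ = 1} = μ {x | ‖inner ℂ w x‖ = 1} := by
      conv_rhs => rw [← hiso Q, Measure.map_apply Q.continuous.measurable hm]
      congr 1
      ext x
      simp [← hQ, Q.inner_map_map]
    rw [h1]
    refine measure_mono_ae ?_
    filter_upwards [hunit] with x hx hwx
    have hx0 : x ≠ 0 := by
      rintro rfl
      simp at hx
    have hw00 : w ≠ 0 := by
      intro h
      simp [h] at hwn
    obtain ⟨r, hr, hxr⟩ := (norm_inner_eq_norm_iff (𝕜 := ℂ) hw00 hx0).1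
      (by rw [hwn, hx, mul_one]; exact hwx)
    have h2 : ((‖w'‖⁻¹ : ℝ) : ℂ) ≠ 0 := by simpa using hne
    refine ⟨?_, ?_⟩
    · rw [hxr, hw]
      simp only [PiLp.smul_apply, smul_eq_mul, hw0, mul_one]
      exact mul_ne_zero hr h2
    · rw [hxr, hw]
      simp only [PiLp.smul_apply, smul_eq_mul, hw0, hw1]
      ring
  have hfin := Measure.finite_const_le_meas_of_disjoint_iUnion μ (pos_iff_ne_zero.2 hp) hAm hAd
    (measure_ne_top _ _)
  exact Set.infinite_univ (hfin.subset fun j _ => hle j)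

theorem dmin_pos_iff (hM : 0 < M) (hn : 2 ≤ n) (F : Codebook M n) :
    0 < dmin F ↔ ∀ i j : Fin M × Fin n, i ≠ j → 0 < distortion (F i.1 i.2) (F j.1 j.2) := by
  -- Over an empty index type the real infimum would be `0`; two vectors of one basis exclude this,
  -- so the infimum is an attained minimum.
  have : Nonempty {p : (Fin M × Fin n) × (Fin M × Fin n) // p.1 ≠ p.2} :=
    ⟨⟨((⟨0, hM⟩, ⟨0, by omega⟩), (⟨0, hM⟩, ⟨1, by omega⟩)), by simp⟩⟩
  refine ⟨fun h i j hij => ?_, fun h => ?_⟩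
  · have h1 : dmin F ≤ distortion (F i.1 i.2) (F j.1 j.2) / 4 :=
      ciInf_le (f := fun p : {p : (Fin M × Fin n) × (Fin M × Fin n) // p.1 ≠ p.2} =>
        distortion (F p.1.1.1 p.1.1.2) (F p.1.2.1 p.1.2.2) / 4)
        (Set.finite_range _).bddBelow ⟨(i, j), hij⟩
    linarith
  · obtain ⟨p, hp⟩ := exists_eq_ciInf_of_finite
      (f := fun p : {p : (Fin M × Fin n) × (Fin M × Fin n) // p.1 ≠ p.2} =>
        distortion (F p.1.1.1 p.1.1.2) (F p.1.2.1 p.1.2.2) / 4)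
    rw [dmin, ← hp]
    exact div_pos (h _ _ p.2) (by norm_num)

theorem distortion_pos {v w : Vec n} (hv : ‖v‖ = 1) (hw : ‖w‖ = 1) (h : ‖inner ℂ v w‖ ≠ 1) :
    0 < distortion v w := by
  have h1 : ‖inner ℂ v w‖ ≤ 1 := (norm_inner_le_norm v w).trans (by rw [hv, hw, mul_one])
  have h2 : ‖inner ℂ v w‖ ^ 2 < 1 :=
    pow_lt_one₀ (norm_nonneg _) (lt_of_le_of_ne h1 h) two_ne_zero
  unfold distortion; linarith

/-- Within a basis all distortions equal 1. Across bases, independence allows one vector to be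
fixed, and the other almost surely misses its line. Only finitely many pairs occur. -/
theorem IsRandomCodebook.ae_dmin_pos {Ω : Type*} [MeasurableSpace Ω] {P : Measure Ω}
    [IsProbabilityMeasure P] {B : Ω → Codebook M n} (hB : IsRandomCodebook P B) (hM : 0 < M)
    (hn : 2 ≤ n) : ∀ᵐ ω ∂P, 0 < dmin (B ω) := by
  have hmeas : ∀ m k, Measurable fun ω => B ω m k := fun m k =>
    (measurable_pi_apply k).comp ((measurable_pi_apply m).comp hB.measurable)
  have hnorm : ∀ ω m k, ‖B ω m k‖ = 1 := fun ω m k => (hB.orthonormal ω m).1 k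
  have hline : ∀ m k v, ‖v‖ = 1 → P.map (fun ω => B ω m k) {x | ‖inner ℂ v x‖ = 1} = 0 := by
    intro m k v hv
    have := Measure.isProbabilityMeasure_map (μ := P) (hmeas m k).aemeasurable
    refine measure_norm_inner_eq_one hn _ ?_ (fun Q => ?_) v hv
    · rw [ae_map_iff (hmeas m k).aemeasurable (measurableSet_eq_fun (by fun_prop) (by fun_prop))]
      exact ae_of_all _ fun ω => hnorm ω m k
    · have hBm : Measurable fun ω => B ω m := (measurable_pi_apply m).comp hB.measurable
      have hQ : Measurable fun ω (k : Fin n) => Q (B ω m k) :=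
        measurable_pi_lambda _ fun k => Q.continuous.measurable.comp (hmeas m k)
      -- Isotropy of the whole basis passes to the marginal law of its `k`-th vector.
      have h1 := congrArg (Measure.map fun x : Fin n → Vec n => x k) (hB.isotropic m Q)
      rw [Measure.map_map (measurable_pi_apply k) hQ,
        Measure.map_map (measurable_pi_apply k) hBm] at h1
      rw [Measure.map_map Q.continuous.measurable (hmeas m k)]
      exact h1
  have hpair : ∀ i j : Fin M × Fin n, i ≠ j →
      ∀ᵐ ω ∂P, 0 < distortion (B ω i.1 i.2) (B ω j.1 j.2) := by
    intro i j hij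
    by_cases hm : i.1 = j.1
    · refine ae_of_all _ fun ω => ?_
      have hk : i.2 ≠ j.2 := fun h => hij (Prod.ext hm h)
      have h1 : inner ℂ (B ω i.1 i.2) (B ω j.1 j.2) = 0 := by
        rw [hm]; exact (hB.orthonormal ω j.1).2 hk
      simp [distortion, h1]
    · have hind : IndepFun (fun ω => B ω i.1 i.2) (fun ω => B ω j.1 j.2) P :=
        (hB.indep.indepFun hm).comp (measurable_pi_apply i.2) (measurable_pi_apply j.2)
      have hprod := (indepFun_iff_map_prod_eq_prod_map_map (hmeas i.1 i.2).aemeasurable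
        (hmeas j.1 j.2).aemeasurable).1 hind
      have hms : MeasurableSet {p : Vec n × Vec n | ‖inner ℂ p.1 p.2‖ = 1} :=
        measurableSet_eq_fun (by fun_prop) measurable_const
      have h0 : P.map (fun ω => (B ω i.1 i.2, B ω j.1 j.2))
          {p : Vec n × Vec n | ‖inner ℂ p.1 p.2‖ = 1} = 0 := by
        have := Measure.isProbabilityMeasure_map (μ := P) (hmeas j.1 j.2).aemeasurable
        rw [hprod, Measure.measure_prod_null hms]
        have hu : ∀ᵐ x ∂P.map (fun ω => B ω i.1 i.2), ‖x‖ = 1 := by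
          rw [ae_map_iff (hmeas i.1 i.2).aemeasurable
            (measurableSet_eq_fun (by fun_prop) (by fun_prop))]
          exact ae_of_all _ fun ω => hnorm ω _ _
        filter_upwards [hu] with x hx
        exact hline j.1 j.2 x hx
      rw [Measure.map_apply ((hmeas i.1 i.2).prodMk (hmeas j.1 j.2)) hms] at h0
      filter_upwards [measure_eq_zero_iff_ae_notMem.1 h0] with ω hω
      exact distortion_pos (hnorm _ _ _) (hnorm _ _ _) hω
  have hall : ∀ᵐ ω ∂P, ∀ i j : Fin M × Fin n, i ≠ j →
      0 < distortion (B ω i.1 i.2) (B ω j.1 j.2) := by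
    simp only [ae_all_iff]
    exact hpair
  filter_upwards [hall] with ω hω
  exact (dmin_pos_iff hM hn _).2 hω

/-! ### Reliable channels exist with probability tending to one -/

/-- The channels that make a user of `goodUserSet` whose distortion from `F m k` is below `1 / 2`,
as long as there are `exp L` users. -/
def reliable (δ L : ℝ) (m : Fin M) (k : Fin n) : Set (Codebook M n × Vec n) :=
  (cell m k ∩ goodRange δ L) ∩ {p | distortion (p.1 m k) (shape p.2) < 1 / 2}

theorem measurableSet_reliable (δ L : ℝ) (m : Fin M) (k : Fin n) :
    MeasurableSet (reliable δ L m k) :=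
  ((measurableSet_cell m k).inter (measurableSet_goodRange δ L)).inter
    (measurableSet_lt (measurable_distortion_shape m k) measurable_const)

/-- Write `r (shape x - v) = (r - ‖x‖) shape x + (x - r v)`; both terms have norm at most `D`. -/
theorem norm_shape_sub_le {v x : Vec n} {r D : ℝ} (hv : ‖v‖ = 1) (hr : 0 < r)
    (hx : ‖x - (r : ℂ) • v‖ ≤ D) : ‖shape x - v‖ ≤ 2 * D / r := by
  have hrv : ‖(r : ℂ) • v‖ = r := by
    rw [norm_smul, hv, mul_one, Complex.norm_real, Real.norm_of_nonneg hr.le]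
  have h1 : (‖x‖ : ℂ) • shape x = x := by
    by_cases h0 : x = 0
    · simp [h0, shape]
    · have : (‖x‖ : ℂ) ≠ 0 := by simpa using h0
      rw [shape, smul_smul]
      push_cast
      rw [mul_inv_cancel₀ this, one_smul]
  have h2 : (r : ℂ) • (shape x - v) = ((r - ‖x‖ : ℝ) : ℂ) • shape x + (x - (r : ℂ) • v) := by
    push_cast
    rw [sub_smul, smul_sub, h1]
    abel
  have h3 : |r - ‖x‖| ≤ D := by
    have := abs_norm_sub_norm_le ((r : ℂ) • v) x
    rw [hrv, norm_sub_rev] at this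
    exact this.trans hx
  have h4 : r * ‖shape x - v‖ ≤ 2 * D := by
    calc r * ‖shape x - v‖ = ‖(r : ℂ) • (shape x - v)‖ := by
          rw [norm_smul, Complex.norm_real, Real.norm_of_nonneg hr.le]
      _ ≤ ‖((r - ‖x‖ : ℝ) : ℂ) • shape x‖ + ‖x - (r : ℂ) • v‖ := by
          rw [h2]; exact norm_add_le _ _
      _ ≤ |r - ‖x‖| * 1 + D := by
          rw [norm_smul, Complex.norm_real, Real.norm_eq_abs]
          gcongr
          exact norm_shape_le x
      _ ≤ 2 * D := by linarith
  rw [le_div_iff₀ hr]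
  linarith

/-- Vectors close to a large multiple of a codebook vector are reliable channels. -/
theorem eventually_closedBall_subset_reliable (hM : 0 < M) (hn : 2 ≤ n) {F : Codebook M n}
    (hF : ∀ m, Orthonormal ℂ (F m)) (hd : 0 < dmin F) {δ : ℝ} (hδ : 0 < δ) (hδ1 : δ < 1)
    {D : ℝ} (hD : 0 ≤ D) (m : Fin M) (k : Fin n) :
    ∀ᶠ r : ℝ in atTop, Metric.closedBall ((r : ℂ) • F m k) D ⊆
      {x | (F, x) ∈ reliable δ (r ^ 2 / (1 - δ / 2)) m k} := by
  set v := F m k with hv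
  have hv1 : ‖v‖ = 1 := (hF m).1 k
  have hcont : ∀ w : Vec n, Continuous fun s : Vec n => distortion w s := by
    intro w; unfold distortion; fun_prop
  have hvv : distortion v v = 0 := by
    simp [distortion, hv1, inner_self_eq_norm_sq_to_K]
  have hpos := (dmin_pos_iff hM hn F).1 hd
  -- These are finitely many strict inequalities between continuous functions, and they hold at `s =
  -- v`, where the distortion from `v` is 0.
  have hN : ∀ᶠ s in 𝓝 v, (∀ i : Fin M × Fin n, i ≠ (m, k) →
      distortion v s < distortion (F i.1 i.2) s) ∧ distortion v s < dmin F ∧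
      distortion v s < 1 / 2 := by
    refine (eventually_all.2 fun i => ?_).and (Eventually.and ?_ ?_)
    · by_cases hi : i = (m, k)
      · simp [hi]
      · have : distortion v v < distortion (F i.1 i.2) v := by
          rw [hvv]; exact hpos i (m, k) hi
        filter_upwards [(hcont v).continuousAt.eventually_lt (hcont (F i.1 i.2)).continuousAt this]
          with s hs _ using hs
    · exact (hcont v).continuousAt.eventually_lt continuousAt_const (by rw [hvv]; exact hd)
    · exact (hcont v).continuousAt.eventually_lt continuousAt_const (by rw [hvv]; norm_num)
  obtain ⟨ε, hε, hball⟩ := Metric.eventually_nhds_iff.1 hN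
  -- `r > 2 D / ε` controls the direction; `4 D ≤ δ r` makes the radial deviation fit into the slack
  -- between `1 - δ / 2` and `1 ± δ` in the power.
  filter_upwards [eventually_gt_atTop 0, eventually_ge_atTop D, eventually_ge_atTop (4 * D / δ),
    eventually_gt_atTop (2 * D / ε)] with r hr0 hrD hr4 hrε x hx
  rw [mem_closedBall_iff_norm] at hx
  have hδ2 : 0 < 1 - δ / 2 := by linarith
  have h4 : 4 * D ≤ δ * r := by rw [div_le_iff₀ hδ] at hr4; linarith
  have hshape : dist (shape x) v < ε := by
    rw [dist_eq_norm]
    refine (norm_shape_sub_le hv1 hr0 hx).trans_lt ?_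
    rw [div_lt_iff₀ hε] at hrε
    rw [div_lt_iff₀ hr0]; linarith
  obtain ⟨hc1, hc2, hc3⟩ := hball hshape
  have hrv : ‖(r : ℂ) • v‖ = r := by
    rw [norm_smul, hv1, mul_one, Complex.norm_real, Real.norm_of_nonneg hr0.le]
  have hnorm := abs_le.1 ((abs_norm_sub_norm_le x ((r : ℂ) • v)).trans hx)
  rw [hrv] at hnorm
  refine ⟨⟨hc1, (quantError_le F x m k).trans_lt hc2, ?_, ?_⟩, hc3⟩
  · have h1 : (r - D) ^ 2 ≤ power x := by
      unfold power
      have : 0 ≤ r - D := by linarith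
      gcongr
      linarith [hnorm.1]
    refine le_trans ?_ h1
    rw [mul_div_assoc', div_le_iff₀ hδ2]
    nlinarith [mul_le_mul_of_nonneg_left h4 hr0.le, mul_nonneg hr0.le hD, sq_nonneg D,
      mul_nonneg (mul_nonneg hr0.le hD) hδ.le, mul_nonneg (sq_nonneg D) hδ2.le]
  · have h1 : power x ≤ (r + D) ^ 2 := by
      unfold power
      gcongr
      linarith [hnorm.2]
    refine h1.trans ?_
    rw [mul_div_assoc', le_div_iff₀ hδ2]
    have h5 : (r + D) ^ 2 ≤ r ^ 2 + 3 * (r * D) := by nlinarith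
    have h6 : (r + D) ^ 2 * (1 - δ / 2) ≤ (r + D) ^ 2 :=
      mul_le_of_le_one_right (sq_nonneg _) (by linarith)
    nlinarith [mul_le_mul_of_nonneg_left h4 hr0.le, mul_nonneg hr0.le hD]

/-- For `r ^ 2 = (1 - δ / 2) L` and `L = log U`, the ball about `r F m k` is eventually reliable,
and `U` times its mass is at least `c exp (δ L / 2 - K r)`. -/
theorem tendsto_mul_measure_reliable (hM : 0 < M) (hn : 2 ≤ n) {F : Codebook M n}
    (hF : ∀ m, Orthonormal ℂ (F m)) (hd : 0 < dmin F) {δ : ℝ} (hδ : 0 < δ) (hδ1 : δ < 1)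
    (m : Fin M) (k : Fin n) :
    Tendsto (fun U : ℕ => (U : ℝ) *
      (complexGaussian n).real {x | (F, x) ∈ reliable δ (Real.log U) m k}) atTop atTop := by
  obtain ⟨c, hc, K, -, hball⟩ := exists_complexGaussian_closedBall_ge n
  have hδ2 : 0 < 1 - δ / 2 := by linarith
  have hlog : Tendsto (fun U : ℕ => Real.log U) atTop atTop :=
    Real.tendsto_log_atTop.comp tendsto_natCast_atTop_atTop
  have hr : Tendsto (fun U : ℕ => √((1 - δ / 2) * Real.log U)) atTop atTop :=
    Real.tendsto_sqrt_atTop.comp (hlog.const_mul_atTop hδ2)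
  have hlim := ((tendsto_exp_linear_sub_sqrt (δ / 2) (K * √(1 - δ / 2)) (by linarith)).comp
    hlog).const_mul_atTop hc
  refine tendsto_atTop_mono' _ ?_ hlim
  filter_upwards [hr.eventually (eventually_closedBall_subset_reliable hM hn hF hd hδ hδ1
    (Real.sqrt_nonneg (2 * n)) m k), hlog.eventually_ge_atTop 0, eventually_gt_atTop 0]
    with U hU hL hU0
  have hU0' : (0 : ℝ) < U := by exact_mod_cast hU0
  set L := Real.log U with hLdef
  set r := √((1 - δ / 2) * L) with hrdef
  have hr2 : r ^ 2 = (1 - δ / 2) * L := Real.sq_sqrt (by positivity)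
  have hr' : r = √(1 - δ / 2) * √L := Real.sqrt_mul hδ2.le _
  have hrL : r ^ 2 / (1 - δ / 2) = L := by rw [hr2, mul_div_cancel_left₀ _ hδ2.ne']
  rw [hrL] at hU
  have hnorm : ‖(r : ℂ) • F m k‖ = r := by
    rw [norm_smul, (hF m).1 k, mul_one, Complex.norm_real,
      Real.norm_of_nonneg (Real.sqrt_nonneg _)]
  have h1 := (hball ((r : ℂ) • F m k)).trans (measureReal_mono hU)
  rw [hnorm] at h1
  have h2 : (U : ℝ) = Real.exp L := (Real.exp_log hU0').symm
  calc c * Real.exp (δ / 2 * L - K * √(1 - δ / 2) * √L)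
      = Real.exp L * (c * Real.exp (-(r ^ 2 + K * r))) := by
        rw [mul_left_comm, ← Real.exp_add, hr2, hr']
        congr 2; ring
    _ ≤ _ := by rw [← h2]; gcongr

/-- By independence of the users, all of them fail with probability `(1 - p) ^ U ≤ exp (-U p)`, and
`U p` tends to infinity. -/
theorem tendsto_measure_exists_reliable {Ω : Type*} [MeasurableSpace Ω] {P : Measure Ω}
    [IsProbabilityMeasure P] {h : ℕ → Ω → Vec n} (hh : IsRayleighChannel P h)
    (hM : 0 < M) (hn : 2 ≤ n) {F : Codebook M n} (hF : ∀ m, Orthonormal ℂ (F m))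
    (hd : 0 < dmin F) {δ : ℝ} (hδ : 0 < δ) (hδ1 : δ < 1) (m : Fin M) (k : Fin n) :
    Tendsto (fun U : ℕ => P.real {ω | ∃ u < U, (F, h u ω) ∈ reliable δ (Real.log U) m k})
      atTop (𝓝 1) := by
  have hlim : Tendsto (fun U : ℕ => 1 - Real.exp (-((U : ℝ) *
      (complexGaussian n).real {x | (F, x) ∈ reliable δ (Real.log U) m k}))) atTop (𝓝 (1 - 0)) :=
    tendsto_const_nhds.sub (Real.tendsto_exp_neg_atTop_nhds_zero.comp
      (tendsto_mul_measure_reliable hM hn hF hd hδ hδ1 m k))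
  rw [sub_zero] at hlim
  refine tendsto_of_tendsto_of_tendsto_of_le_of_le hlim tendsto_const_nhds (fun U => ?_)
    fun U => measureReal_le_one
  set G : Set (Vec n) := {x | (F, x) ∈ reliable δ (Real.log U) m k} with hG
  have hGm : MeasurableSet G := (measurableSet_reliable δ _ m k).preimage (by fun_prop)
  have hset : {ω | ∃ u < U, (F, h u ω) ∈ reliable δ (Real.log U) m k} =
      (⋂ u ∈ Finset.range U, h u ⁻¹' Gᶜ)ᶜ := by
    ext ω; simp [hG]
  have hGi : ∀ u, MeasurableSet (h u ⁻¹' Gᶜ) := fun u => hh.measurable u hGm.compl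
  have hprod : P.real (⋂ u ∈ Finset.range U, h u ⁻¹' Gᶜ) =
      (1 - (complexGaussian n).real G) ^ U := by
    rw [measureReal_def, hh.indep.measure_inter_preimage_eq_mul (Finset.range U) (sets := fun _ => Gᶜ)
      (fun _ _ => hGm.compl),
      ENNReal.toReal_prod]
    have : ∀ u, (P (h u ⁻¹' Gᶜ)).toReal = 1 - (complexGaussian n).real G := by
      intro u
      rw [← probReal_compl_eq_one_sub hGm, measureReal_def, ← hh.law u,
        Measure.map_apply (hh.measurable u) hGm.compl]
    rw [Finset.prod_congr rfl fun u _ => this u, Finset.prod_const, Finset.card_range]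
  rw [hset, probReal_compl_eq_one_sub (Finset.measurableSet_biInter _ fun u _ => hGi u), hprod]
  have hp1 : (complexGaussian n).real G ≤ 1 := measureReal_le_one
  have h1 : (1 - (complexGaussian n).real G) ^ U ≤
      Real.exp (-(complexGaussian n).real G) ^ U :=
    pow_le_pow_left₀ (by linarith) (by linarith [Real.add_one_le_exp (-(complexGaussian n).real G)]) U
  rw [← Real.exp_nat_mul, mul_neg] at h1
  linarith

/-- A codebook that is independent of the channels can be conditioned upon. -/
theorem tendsto_measure_exists_reliable_random {Ω : Type*} [MeasurableSpace Ω] {P : Measure Ω}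
    [IsProbabilityMeasure P] {h : ℕ → Ω → Vec n} (hh : IsRayleighChannel P h)
    (hM : 0 < M) (hn : 2 ≤ n) {B : Ω → Codebook M n} (hBm : Measurable B)
    (hB : ∀ ω m, Orthonormal ℂ (B ω m)) (hd : ∀ᵐ ω ∂P, 0 < dmin (B ω))
    (hBh : IndepFun B (fun ω u => h u ω) P)
    {δ : ℝ} (hδ : 0 < δ) (hδ1 : δ < 1) (m : Fin M) (k : Fin n) :
    Tendsto (fun U : ℕ => P.real {ω | ∃ u < U, (B ω, h u ω) ∈ reliable δ (Real.log U) m k})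
      atTop (𝓝 1) := by
  have hhm : Measurable fun ω u => h u ω := measurable_pi_lambda _ hh.measurable
  have hprod := (indepFun_iff_map_prod_eq_prod_map_map hBm.aemeasurable hhm.aemeasurable).1 hBh
  let E : ℕ → Set (Codebook M n × (ℕ → Vec n)) := fun U =>
    {p | ∃ u < U, (p.1, p.2 u) ∈ reliable δ (Real.log U) m k}
  have hE : ∀ U, MeasurableSet (E U) := by
    intro U
    have : E U = ⋃ u ∈ Finset.range U,
        (fun p : Codebook M n × (ℕ → Vec n) => (p.1, p.2 u)) ⁻¹' reliable δ (Real.log U) m k := by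
      ext p; simp [E]
    rw [this]
    exact Finset.measurableSet_biUnion _ fun u _ => (measurableSet_reliable δ _ m k).preimage
      (measurable_fst.prodMk ((measurable_pi_apply u).comp measurable_snd))
  have hpm := Measure.isProbabilityMeasure_map (μ := P) hhm.aemeasurable
  have hsec : ∀ (U : ℕ) F, (P.map fun ω u => h u ω) (Prod.mk F ⁻¹' E U) =
      P {ω | ∃ u < U, (F, h u ω) ∈ reliable δ (Real.log U) m k} := fun U F =>
    Measure.map_apply hhm ((hE U).preimage measurable_prodMk_left)
  -- Fubini for the product of the laws of codebook and channels. The fixed-codebook limit then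
  -- passes through the outer integral by dominated convergence, with bound 1.
  have hcond : ∀ U : ℕ, P {ω | ∃ u < U, (B ω, h u ω) ∈ reliable δ (Real.log U) m k} =
      ∫⁻ ω', P {ω | ∃ u < U, (B ω', h u ω) ∈ reliable δ (Real.log U) m k} ∂P := by
    intro U
    have h1 := congrArg (fun μ => μ (E U)) hprod
    rw [Measure.map_apply (hBm.prodMk hhm) (hE U), Measure.prod_apply (hE U),
      lintegral_map (measurable_measure_prodMk_left (hE U)) hBm] at h1
    exact h1.trans (lintegral_congr fun ω' => hsec U (B ω'))
  have hmeas : ∀ U : ℕ, Measurable fun ω' =>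
      P {ω | ∃ u < U, (B ω', h u ω) ∈ reliable δ (Real.log U) m k} := by
    intro U
    have h1 : (fun ω' => P {ω | ∃ u < U, (B ω', h u ω) ∈ reliable δ (Real.log U) m k}) =
        (fun F => (P.map fun ω u => h u ω) (Prod.mk F ⁻¹' E U)) ∘ B :=
      funext fun ω' => (hsec U (B ω')).symm
    rw [h1]
    exact (measurable_measure_prodMk_left (hE U)).comp hBm
  have hlim : Tendsto (fun U : ℕ => ∫⁻ ω', P {ω | ∃ u < U,
      (B ω', h u ω) ∈ reliable δ (Real.log U) m k} ∂P) atTop (𝓝 (∫⁻ _, 1 ∂P)) := by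
    refine tendsto_lintegral_of_dominated_convergence (fun _ => 1) hmeas
      (fun U => ae_of_all _ fun _ => prob_le_one) (by simp) ?_
    filter_upwards [hd] with ω' hω'
    have h1 := tendsto_measure_exists_reliable hh hM hn (hB ω') hω' hδ hδ1 m k
    have h2 := ENNReal.tendsto_ofReal h1
    simpa [measureReal_def] using h2
  rw [lintegral_one, measure_univ] at hlim
  replace hlim := hlim.congr fun U => (hcond U).symm
  simpa [measureReal_def, Function.comp_def] using (ENNReal.tendsto_toReal ENNReal.one_ne_top).comp hlim

/-! ### Expectations and the scaling law -/

section

variable {Ω : Type*} [MeasurableSpace Ω] {P : Measure Ω}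
  {h : ℕ → Ω → Vec n} {B : Ω → Codebook M n} {γ : ℝ}

theorem IsRayleighChannel.integrable_exp (hh : IsRayleighChannel P h) (u : ℕ) :
    Integrable (fun ω => Real.exp (power (h u ω) / 2)) P := by
  have h1 := integrable_exp_half_power n
  rw [← hh.law u] at h1
  exact h1.comp_measurable (hh.measurable u)

theorem IsRayleighChannel.integral_exp (hh : IsRayleighChannel P h) (u : ℕ) :
    ∫ ω, Real.exp (power (h u ω) / 2) ∂P = ∫ x, Real.exp (power x / 2) ∂complexGaussian n := by
  have h1 := (integrable_exp_half_power n).aestronglyMeasurable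
  rw [← hh.law u] at h1 ⊢
  exact (integral_map (hh.measurable u).aemeasurable h1).symm

variable [IsProbabilityMeasure P]

theorem one_le_integral_exp (n : ℕ) : 1 ≤ ∫ x, Real.exp (power x / 2) ∂complexGaussian n := by
  calc (1 : ℝ) = ∫ _, (1 : ℝ) ∂complexGaussian n := by simp
    _ ≤ _ := integral_mono (integrable_const _) (integrable_exp_half_power n) fun x =>
        Real.one_le_exp (div_nonneg (power_nonneg x) two_pos.le)

theorem IsRayleighChannel.integrable_bound (hh : IsRayleighChannel P h) (U : ℕ) (γ a b : ℝ) :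
    Integrable (fun ω => n * (Real.log b + (1 + 2 * γ * (Real.log a +
      (∑ u ∈ Finset.range U, Real.exp (power (h u ω) / 2)) / a)) / b - 1)) P := by
  have h1 := integrable_finsetSum (Finset.range U) fun u _ => hh.integrable_exp u
  have h2 := ((integrable_const (Real.log a)).add (h1.div_const a)).const_mul (2 * γ)
  have h3 := ((integrable_const 1).add h2).div_const b
  exact (((integrable_const (Real.log b)).add h3).sub (integrable_const 1)).const_mul (n : ℝ)

theorem integrable_sumRate [Nonempty (Fin M)] [Nonempty (Fin n)] (hγ : 0 ≤ γ)
    (hh : IsRayleighChannel P h) (hBm : Measurable B) (hB : ∀ ω m, Orthonormal ℂ (B ω m))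
    {S : Ω → Fin M → Fin n → Finset ℕ} (hSm : ∀ m k u, MeasurableSet {ω | u ∈ S ω m k})
    {U : ℕ} (hS : ∀ ω m k, ∀ u ∈ S ω m k, u < U) :
    Integrable (fun ω => sumRate γ (B ω) (fun u => h u ω) (S ω)) P := by
  refine (hh.integrable_bound U γ 1 1).mono'
    (measurable_sumRate γ hBm hh.measurable hSm).aestronglyMeasurable (ae_of_all _ fun ω => ?_)
  rw [Real.norm_of_nonneg (sumRate_nonneg hγ _ _ _)]
  exact sumRate_le hγ (hB ω) _ (hS ω) le_rfl one_pos

/-- The tangent points of `sumRate_le` are means: `a = U C = E Y`, and `b` is the mean of `1 + 2 γ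
(log a + Y / a)`. The affine bound then integrates to exactly `n log b`. -/
theorem integral_sumRate_le [Nonempty (Fin M)] [Nonempty (Fin n)] (hγ : 0 ≤ γ)
    (hh : IsRayleighChannel P h) (hBm : Measurable B) (hB : ∀ ω m, Orthonormal ℂ (B ω m))
    {S : Ω → Fin M → Fin n → Finset ℕ} (hSm : ∀ m k u, MeasurableSet {ω | u ∈ S ω m k})
    {U : ℕ} (hU : 0 < U) (hS : ∀ ω m k, ∀ u ∈ S ω m k, u < U) :
    ∫ ω, sumRate γ (B ω) (fun u => h u ω) (S ω) ∂P ≤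
      n * Real.log (1 + 2 * γ * (Real.log (∫ x, Real.exp (power x / 2) ∂complexGaussian n) + 1) +
        2 * γ * Real.log U) := by
  set C := ∫ x, Real.exp (power x / 2) ∂complexGaussian n with hC
  have hC1 : 1 ≤ C := one_le_integral_exp n
  have hU1 : (1 : ℝ) ≤ U := by exact_mod_cast hU
  have ha : 1 ≤ U * C := one_le_mul_of_one_le_of_one_le hU1 hC1
  have ha0 : U * C ≠ 0 := by positivity
  set b := 1 + 2 * γ * (Real.log C + 1) + 2 * γ * Real.log U with hb
  have hb0 : 0 < b := by
    have := Real.log_nonneg hC1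
    have := Real.log_nonneg hU1
    positivity
  have hab : b = 1 + 2 * γ * (Real.log (U * C) + 1) := by
    rw [hb, Real.log_mul (by positivity) (by positivity)]; ring
  refine (integral_mono (integrable_sumRate hγ hh hBm hB hSm hS)
    (hh.integrable_bound U γ (U * C) b) fun ω => sumRate_le hγ (hB ω) _ (hS ω) ha hb0).trans_eq ?_
  have h1 := integrable_finsetSum (Finset.range U) fun u _ => hh.integrable_exp u
  have h2 := h1.div_const (U * C)
  have h3 := ((integrable_const (Real.log (U * C))).add h2).const_mul (2 * γ)
  have h4 := ((integrable_const 1).add h3).div_const b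
  have h5 := (integrable_const (Real.log b)).add h4
  simp only [Pi.add_def] at h3 h4 h5
  rw [integral_const_mul, integral_sub h5 (integrable_const 1), integral_add (integrable_const _) h4, integral_div, integral_add (integrable_const _) h3,
    integral_const_mul, integral_add (integrable_const _) h2, integral_div,
    integral_finsetSum _ fun u _ => hh.integrable_exp u]
  simp only [hh.integral_exp, ← hC, integral_const, probReal_univ, Finset.sum_const,
    Finset.card_range, smul_eq_mul, nsmul_eq_mul, one_mul]
  rw [div_self ha0, ← hab, div_self hb0.ne']
  ring

/-- Reliable channels give a lower bound for the sum rate. -/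
theorem le_sumRate_goodUserSet [Nonempty (Fin M)] [Nonempty (Fin n)] (hγ : 0 ≤ γ) {δ : ℝ}
    (hδ1 : δ ≤ 1) (F : Codebook M n) (h : ℕ → Vec n) {U : ℕ} (m : Fin M) :
    ∑ k : Fin n, {h : ℕ → Vec n | ∃ u < U, (F, h u) ∈ reliable δ (Real.log U) m k}.indicator
        (fun _ => Real.log (1 + γ * (1 - δ) / 2 * Real.log U)) h ≤
      sumRate γ F h (goodUserSet δ F h U) := by
  refine (Finset.sum_le_sum fun k _ => ?_).trans (sum_le_sumRate γ F h _ m)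
  have hL : 0 ≤ Real.log U := Real.log_natCast_nonneg U
  have h0 := maxOrZero_nonneg (goodUserSet δ F h U m k) fun u => sinr_nonneg hγ F (h u)
  by_cases hh : h ∈ {h : ℕ → Vec n | ∃ u < U, (F, h u) ∈ reliable δ (Real.log U) m k}
  · rw [Set.indicator_of_mem hh]
    obtain ⟨u, hu, ⟨hc, hg⟩, hd⟩ := hh
    have hle : sinr γ F (h u) ≤ maxOrZero (goodUserSet δ F h U m k) fun u => sinr γ F (h u) :=
      le_maxOrZero (f := fun u => sinr γ F (h u)) (mem_goodUserSet.2 ⟨⟨hu, hc⟩, hg⟩)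
    -- The threshold `1 / 2` in `reliable` costs only a constant factor in the SINR, which
    -- disappears in `log log U`.
    have hq : 1 / 2 ≤ 1 - quantError F (h u) := by
      have := quantError_le F (h u) m k
      have hd' : distortion (F m k) (shape (h u)) < 1 / 2 := hd
      linarith
    have hp : (1 - δ) * Real.log U ≤ power (h u) := hg.2.1
    have h1 : 0 ≤ (1 - δ) * Real.log U := mul_nonneg (by linarith) hL
    have h2 : γ * ((1 - δ) * Real.log U) * (1 / 2) ≤ sinr γ F (h u) := by
      unfold sinr
      have := power_nonneg (h u)
      gcongr
    have h3 : 0 ≤ γ * ((1 - δ) * Real.log U) * (1 / 2) := by positivity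
    exact Real.log_le_log (by linarith) (by linarith)
  · rw [Set.indicator_of_notMem hh]
    exact Real.log_nonneg (by linarith)

theorem goodUserSet_subset (δ : ℝ) (F : Codebook M n) (h : ℕ → Vec n) (U : ℕ) (m : Fin M)
    (k : Fin n) : goodUserSet δ F h U m k ⊆ userSet F h U m k :=
  Finset.filter_subset _ _

theorem goodUserSet_mono {δ δ' : ℝ} (hδ : δ ≤ δ') (F : Codebook M n) (h : ℕ → Vec n) (U : ℕ)
    (m : Fin M) (k : Fin n) : goodUserSet δ F h U m k ⊆ goodUserSet δ' F h U m k := by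
  intro u hu
  have hL : 0 ≤ Real.log U := Real.log_natCast_nonneg U
  rw [mem_goodUserSet] at hu ⊢
  obtain ⟨h1, h2, h3, h4⟩ := hu
  exact ⟨h1, h2, le_trans (by gcongr) h3, h4.trans (by gcongr)⟩

/-- One basis already suffices. By linearity of expectation, no independence between the events for
different `k` is needed. -/
theorem le_goodThroughput [Nonempty (Fin M)] [Nonempty (Fin n)] (hγ : 0 ≤ γ) {δ : ℝ}
    (hδ1 : δ ≤ 1) (hh : IsRayleighChannel P h) (hBm : Measurable B)
    (hB : ∀ ω m, Orthonormal ℂ (B ω m)) (U : ℕ) (m : Fin M) :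
    (∑ k : Fin n, P.real {ω | ∃ u < U, (B ω, h u ω) ∈ reliable δ (Real.log U) m k}) *
        Real.log (1 + γ * (1 - δ) / 2 * Real.log U) ≤ goodThroughput P γ δ B h U := by
  have hm : ∀ k, MeasurableSet {ω | ∃ u < U, (B ω, h u ω) ∈ reliable δ (Real.log U) m k} := by
    intro k
    have : {ω | ∃ u < U, (B ω, h u ω) ∈ reliable δ (Real.log U) m k} = ⋃ u ∈ Finset.range U,
        (fun ω => (B ω, h u ω)) ⁻¹' reliable δ (Real.log U) m k := by
      ext p; simp
    rw [this]
    exact Finset.measurableSet_biUnion _ fun u _ =>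
      (hBm.prodMk (hh.measurable u)) (measurableSet_reliable δ _ m k)
  set c := Real.log (1 + γ * (1 - δ) / 2 * Real.log U) with hc
  have hint : ∀ k, Integrable ({ω | ∃ u < U, (B ω, h u ω) ∈ reliable δ (Real.log U) m k}.indicator
      fun _ => c) P := fun k => (integrable_const c).indicator (hm k)
  calc _ = ∫ ω, ∑ k : Fin n, {ω | ∃ u < U, (B ω, h u ω) ∈ reliable δ (Real.log U) m k}.indicator
          (fun _ => c) ω ∂P := by
        rw [integral_finsetSum _ fun k _ => hint k, Finset.sum_mul]
        refine Finset.sum_congr rfl fun k _ => ?_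
        rw [integral_indicator_const c (hm k), smul_eq_mul]
    _ ≤ _ := by
        refine integral_mono (integrable_finsetSum _ fun k _ => hint k)
          (integrable_sumRate hγ hh hBm hB
            (fun m k u => measurableSet_mem_goodUserSet δ hBm hh.measurable U m k u)
            fun ω m k u hu => (mem_goodUserSet.1 hu).1.1) fun ω => ?_
        exact le_sumRate_goodUserSet hγ hδ1 (B ω) (fun u => h u ω) m

/-- The scaling law for a codebook that is independent of the channels and has almost surely a
positive minimum distance. -/
theorem throughput_scaling (hM : 0 < M) (hn : 2 ≤ n) (hγ : 0 < γ) (hh : IsRayleighChannel P h)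
    (hBm : Measurable B) (hB : ∀ ω m, Orthonormal ℂ (B ω m)) (hd : ∀ᵐ ω ∂P, 0 < dmin (B ω))
    (hBh : IndepFun B (fun ω u => h u ω) P) :
    (∀ U : ℕ, Integrable (fun ω => sumRate γ (B ω) (fun u => h u ω)
      (userSet (B ω) (fun u => h u ω) U)) P) ∧
    Tendsto (fun U : ℕ => throughput P γ B h U / (n * Real.log (Real.log U))) atTop (𝓝 1) ∧
    (∀ δ : ℝ, 0 < δ → Tendsto
      (fun U : ℕ => goodThroughput P γ δ B h U / (n * Real.log (Real.log U))) atTop (𝓝 1)) := by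
  have : Nonempty (Fin M) := ⟨⟨0, hM⟩⟩
  have : Nonempty (Fin n) := ⟨⟨0, by omega⟩⟩
  have hn0 : (0 : ℝ) < n := by exact_mod_cast (by omega : 0 < n)
  have hint : ∀ U : ℕ, Integrable (fun ω => sumRate γ (B ω) (fun u => h u ω)
      (userSet (B ω) (fun u => h u ω) U)) P := fun U =>
    integrable_sumRate hγ.le hh hBm hB
      (fun m k u => measurableSet_mem_userSet hBm hh.measurable U m k u)
      fun ω m k u hu => (mem_userSet.1 hu).1
  have hintg : ∀ (δ : ℝ) (U : ℕ), Integrable (fun ω => sumRate γ (B ω) (fun u => h u ω)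
      (goodUserSet δ (B ω) (fun u => h u ω) U)) P := fun δ U =>
    integrable_sumRate hγ.le hh hBm hB
      (fun m k u => measurableSet_mem_goodUserSet δ hBm hh.measurable U m k u)
      fun ω m k u hu => (mem_goodUserSet.1 hu).1.1
  have hle : ∀ δ U, goodThroughput P γ δ B h U ≤ throughput P γ B h U := fun δ U =>
    integral_mono (hintg δ U) (hint U) fun ω =>
      sumRate_mono hγ.le _ _ fun m k => goodUserSet_subset δ _ _ U m k
  have hmono : ∀ {δ δ' : ℝ}, δ ≤ δ' → ∀ U,
      goodThroughput P γ δ B h U ≤ goodThroughput P γ δ' B h U := fun hδ U =>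
    integral_mono (hintg _ U) (hintg _ U) fun ω =>
      sumRate_mono hγ.le _ _ fun m k => goodUserSet_mono hδ _ _ U m k
  have hlog : Tendsto (fun U : ℕ => Real.log U) atTop atTop :=
    Real.tendsto_log_atTop.comp tendsto_natCast_atTop_atTop
  have hpos : ∀ᶠ U : ℕ in atTop, 0 < n * Real.log (Real.log U) := by
    filter_upwards [(Real.tendsto_log_atTop.comp hlog).eventually_gt_atTop 0] with U hU
    exact mul_pos hn0 hU
  set b := 1 + 2 * γ * (Real.log (∫ x, Real.exp (power x / 2) ∂complexGaussian n) + 1)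
  have hupper : Tendsto (fun U : ℕ => n * Real.log (b + 2 * γ * Real.log U) /
      (n * Real.log (Real.log U))) atTop (𝓝 1) := by
    refine ((tendsto_log_affine_div_log (2 * γ) b (by positivity)).comp hlog).congr fun U => ?_
    rw [mul_div_mul_left _ _ hn0.ne']
    rfl
  have hub : ∀ᶠ U : ℕ in atTop, throughput P γ B h U / (n * Real.log (Real.log U)) ≤
      n * Real.log (b + 2 * γ * Real.log U) / (n * Real.log (Real.log U)) := by
    filter_upwards [hpos, eventually_gt_atTop 0] with U hU hU0
    refine div_le_div_of_nonneg_right ?_ hU.le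
    exact integral_sumRate_le hγ.le hh hBm hB
      (fun m k u => measurableSet_mem_userSet hBm hh.measurable U m k u) hU0
      fun ω m k u hu => (mem_userSet.1 hu).1
  let m : Fin M := ⟨0, hM⟩
  have hlower : ∀ δ : ℝ, 0 < δ → δ < 1 → Tendsto (fun U : ℕ =>
      (∑ k : Fin n, P.real {ω | ∃ u < U, (B ω, h u ω) ∈ reliable δ (Real.log U) m k}) *
        Real.log (1 + γ * (1 - δ) / 2 * Real.log U) / (n * Real.log (Real.log U)))
      atTop (𝓝 1) := by
    intro δ hδ hδ1
    have h1 : Tendsto (fun U : ℕ => ∑ k : Fin n,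
        P.real {ω | ∃ u < U, (B ω, h u ω) ∈ reliable δ (Real.log U) m k}) atTop
        (𝓝 (∑ _k : Fin n, 1)) := tendsto_finsetSum _ fun k _ =>
      tendsto_measure_exists_reliable_random hh hM hn hBm hB hd hBh hδ hδ1 m k
    have h2 := (tendsto_log_affine_div_log (γ * (1 - δ) / 2) 1
      (by have : 0 < 1 - δ := by linarith
          positivity)).comp hlog
    have h3 := (h1.div_const (n : ℝ)).mul h2
    simp only [Finset.sum_const, Finset.card_univ, Fintype.card_fin, nsmul_eq_mul, mul_one,
      div_self hn0.ne'] at h3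
    refine h3.congr fun U => ?_
    simp only [Function.comp]
    rw [div_mul_div_comm]
  have hgood : ∀ δ : ℝ, 0 < δ → Tendsto
      (fun U : ℕ => goodThroughput P γ δ B h U / (n * Real.log (Real.log U))) atTop (𝓝 1) := by
    intro δ hδ
    -- The lower bound requires `δ < 1`; for larger `δ` the power window only widens, so the bound
    -- for the smaller value carries over.
    have hδ' : 0 < min δ (1 / 2) := lt_min hδ (by norm_num)
    have hδ1 : min δ (1 / 2) < 1 := (min_le_right _ _).trans_lt (by norm_num)
    refine tendsto_of_tendsto_of_tendsto_of_le_of_le' (hlower _ hδ' hδ1) hupper ?_ ?_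
    · filter_upwards [hpos] with U hU
      exact div_le_div_of_nonneg_right ((le_goodThroughput hγ.le hδ1.le hh hBm hB U m).trans
        (hmono (min_le_left _ _) U)) hU.le
    · filter_upwards [hpos, hub] with U hU hU2
      exact (div_le_div_of_nonneg_right (hle δ U) hU.le).trans hU2
  refine ⟨hint, ?_, hgood⟩
  -- Any positive `δ` would serve here as the lower comparison.
  refine tendsto_of_tendsto_of_tendsto_of_le_of_le' (hgood 1 one_pos) hupper ?_ hub
  filter_upwards [hpos] with U hU
  exact div_le_div_of_nonneg_right (hle 1 U) hU.le

end

end PU2RC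

end

theorem proposition3 {Ω : Type*} [MeasurableSpace Ω] (P : Measure Ω) [IsProbabilityMeasure P]
    (M Nt : ℕ) (hM : 1 ≤ M) (hNt : 2 ≤ Nt) (γ : ℝ) (hγ : 0 < γ)
    (h : ℕ → Ω → PU2RC.Vec Nt) (hh : PU2RC.IsRayleighChannel P h)
    (B : Ω → PU2RC.Codebook M Nt) (hB : PU2RC.IsRandomCodebook P B)
    (hBh : IndepFun B (fun ω u => h u ω) P) :
    -- the randomly generated codebook
    ((∀ᵐ ω ∂P, 0 < PU2RC.dmin (B ω)) ∧
      (∀ U : ℕ, Integrable (fun ω => PU2RC.sumRate γ (B ω) (fun u => h u ω)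
        (PU2RC.userSet (B ω) (fun u => h u ω) U)) P) ∧
      Tendsto (fun U : ℕ => PU2RC.throughput P γ B h U / (Nt * Real.log (Real.log U)))
        atTop (𝓝 1) ∧
      (∀ δ : ℝ, 0 < δ → Tendsto
        (fun U : ℕ => PU2RC.goodThroughput P γ δ B h U / (Nt * Real.log (Real.log U)))
        atTop (𝓝 1))) ∧
    -- every fixed codebook of orthonormal bases with positive minimum distance
    (∀ F : PU2RC.Codebook M Nt, (∀ m, Orthonormal ℂ (F m)) → 0 < PU2RC.dmin F →
      (∀ U : ℕ, Integrable (fun ω => PU2RC.sumRate γ F (fun u => h u ω)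
        (PU2RC.userSet F (fun u => h u ω) U)) P) ∧
      Tendsto (fun U : ℕ => PU2RC.throughput P γ (fun _ => F) h U /
        (Nt * Real.log (Real.log U))) atTop (𝓝 1) ∧
      (∀ δ : ℝ, 0 < δ → Tendsto
        (fun U : ℕ => PU2RC.goodThroughput P γ δ (fun _ => F) h U /
          (Nt * Real.log (Real.log U))) atTop (𝓝 1))) := by
  refine ⟨⟨hB.ae_dmin_pos hM hNt, ?_⟩, fun F hF hd => ?_⟩
  · exact PU2RC.throughput_scaling hM hNt hγ hh hB.measurable hB.orthonormal
      (hB.ae_dmin_pos hM hNt) hBh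
  -- A fixed codebook is a constant random one, hence independent of the channels.
  · exact PU2RC.throughput_scaling hM hNt hγ hh measurable_const (fun _ => hF)
      (ae_of_all _ fun _ => hd) (indepFun_const_left _ _)
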